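/- Let $\mathbb{D}=\{z\in\mathbb{C}:|z|<1\}$. Let $\mathcal{A}$ be the class of analytic functions $f$ in $\mathbb{D}$ with $f(0)=0$, $f'(0)=1$, and let $\mathcal{H}[1,1]$ be the class of analytic functions $p$ in $\mathbb{D}$ with $p(0)=1$. Let $\mathcal{Q}$ be the class of functions $p$ that are analytic and injective on $\overline{\mathbb{D}}\setminus E(p)$, where $E(p)=\{\zeta\in\partial\mathbb{D}:\lim_{z\to\zeta}p(z)=\infty\}$, and satisfy $p'(\zeta)\neq 0$ for $\zeta\in\partial\mathbb{D}\setminus E(p)$. A function is called univalent in $\mathbb{D}$ if it is analytic and injective there. For analytic functions $F,G$ in $\mathbb{D}$, write $F\prec G$ if there is an analytic function $w$ in $\mathbb{D}$ with $w(0)=0$ and $|w(z)|<1$ such that $F(z)=G(w(z))$ for all $z\in\mathbb{D}$. Quotients $zf'(z)/f(z)$ with $f\in\mathcal{A}$ are given the value $1$ at $z=0$, and all powers are principal values. Let $\alpha,\mu$ be real numbers with $0<\mu\le 1$ and $\alpha+\mu>0$, and let $\lambda\in\mathbb{C}$, $\lambda\neq 0$. Let $g_1,g_2\in\mathcal{A}$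 be such that $q_i(z)=zg_i'(z)/g_i(z)$ $(i=1,2)$ are univalent in $\mathbb{D}$ and satisfy, for all $z\in\mathbb{D}$, $$\operatorname{Re}\left(\frac1\lambda q_i(z)\right)>0\quad\text{and}\quad \operatorname{Re}\left(\left(\frac{\alpha}{\mu}-1\right)\frac{zq_i'(z)}{q_i(z)}+1+\frac{zq_i''(z)}{q_i'(z)}\right)>0 .$$ Put $$h_i(z)=\left(\frac{zg_i'(z)}{g_i(z)}\right)^{\alpha}\left((1-\lambda)\frac{zg_i'(z)}{g_i(z)}+\lambda\left(1+\frac{zg_i''(z)}{g_i'(z)}\right)\right)^{\mu}\quad(i=1,2).$$ Let $f\in\mathcal{A}$ be such that $zf'(z)/f(z)$ has no zero in $\mathbb{D}$ and belongs to $\mathcal{H}[1,1]\cap\mathcal{Q}$, and such that $$P(z)=\left(\frac{zf'(z)}{f(z)}\right)^{\alpha}\left((1-\lambda)\frac{zf'(z)}{f(z)}+\lambda\left(1+\frac{zf''(z)}{f'(z)}\right)\right)^{\mu}$$ is univalent in $\mathbb{D}$. If $h_1\prec P\prec h_2$ (in particular, $h_1$ and $h_2$ are analytic in $\mathbb{D}$),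 then $$\frac{zg_1'(z)}{g_1(z)}\prec\frac{zf'(z)}{f(z)}\prec\frac{zg_2'(z)}{g_2(z)} .$$ -/

import Mathlib

open Filter Topology

/-- The open unit disk of the complex plane, as a set. -/
abbrev unitDisk : Set ℂ := Metric.ball (0 : ℂ) 1

/-- The class `𝓗[a, n]`: functions analytic in the unit disk whose power series at the origin has
the form `a + aₙ zⁿ + aₙ₊₁ zⁿ⁺¹ + ⋯`. -/
def MemH (a : ℂ) (n : ℕ) (f : ℂ → ℂ) : Prop :=
  AnalyticOnNhd ℂ f unitDisk ∧ f 0 = a ∧ ∀ k : ℕ, 0 < k → k < n → iteratedDeriv k f 0 = 0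

/-- The class `𝓐` of normalized analytic functions in the unit disk: `f(0) = 0`, `f'(0) = 1`. -/
def MemA (f : ℂ → ℂ) : Prop :=
  AnalyticOnNhd ℂ f unitDisk ∧ f 0 = 0 ∧ deriv f 0 = 1

/-- `f` is univalent in the unit disk: analytic and injective there. -/
def UnivalentOnDisk (f : ℂ → ℂ) : Prop :=
  AnalyticOnNhd ℂ f unitDisk ∧ Set.InjOn f unitDisk

/-- Subordination `f ≺ g` of analytic functions in the unit disk: `f = g ∘ w` for a Schwarz
function `w`. -/
def SubordinateTo (f g : ℂ → ℂ) : Prop :=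
  AnalyticOnNhd ℂ f unitDisk ∧ AnalyticOnNhd ℂ g unitDisk ∧
    ∃ w : ℂ → ℂ, AnalyticOnNhd ℂ w unitDisk ∧ w 0 = 0 ∧
      (∀ z ∈ unitDisk, ‖w z‖ < 1) ∧ ∀ z ∈ unitDisk, f z = g (w z)

/-- The exceptional set `E(f)`: the points `ζ` of the unit circle such that `f(z) → ∞` as `z → ζ`
from within the unit disk. -/
def exceptionalSet (f : ℂ → ℂ) : Set ℂ :=
  {ζ | ζ ∈ Metric.sphere (0 : ℂ) 1 ∧ Tendsto f (𝓝[unitDisk] ζ) (Bornology.cobounded ℂ)}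

/-- The class `𝓠`: functions on the unit disk that are analytic and injective on the closed unit
disk without `E(f)`, with nonvanishing derivative at the points of the unit circle outside `E(f)`.
Only the values of `f` in the open disk matter; the values at the boundary are those of the
(necessarily unique) analytic extension `F`. -/
def MemQ (f : ℂ → ℂ) : Prop :=
  ∃ F : ℂ → ℂ, Set.EqOn F f unitDisk ∧
    AnalyticOnNhd ℂ F (Metric.closedBall (0 : ℂ) 1 \ exceptionalSet f) ∧
    Set.InjOn F (Metric.closedBall (0 : ℂ) 1 \ exceptionalSet f) ∧
    ∀ ζ ∈ Metric.sphere (0 : ℂ) 1 \ exceptionalSet f, deriv F ζ ≠ 0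

/-- The function `z f'(z) / f(z)`, with its removable singularity at the origin filled in by the
value `1`, which is its limit there for every `f` in the class `𝓐`. -/
noncomputable def starQuot (f : ℂ → ℂ) : ℂ → ℂ :=
  Function.update (fun z => z * deriv f z / f z) 0 1

/-- The function
`(z f'(z) / f(z)) ^ α * ((1 - l) z f'(z) / f(z) + l (1 + z f''(z) / f'(z))) ^ μ`,
with principal powers. -/
noncomputable def mixedExpr (α μ : ℝ) (l : ℂ) (f : ℂ → ℂ) (z : ℂ) : ℂ :=
  starQuot f z ^ (α : ℂ) *
    ((1 - l) * starQuot f z + l * (1 + z * deriv (deriv f) z / deriv f z)) ^ (μ : ℂ)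

/-! Write `starQuot f = exp u` and `b = α / μ`. Up to branches of the powers, `mixedExpr` is the
`μ`-th power of `logExpr b l u = T + z S`, with `T = exp ((b + 1) u)` and `S = l u' exp (b u)`.
Comparing moduli removes the branches: `‖mixedExpr‖ = ‖logExpr‖ ^ μ`, and analytic functions of
equal modulus that share a nonzero value at `0` coincide. Hence the subordinations pass to `logExpr`
with the same Schwarz functions.

For `g₁` and `g₂` the hypotheses say `Re (T' / S) > 0` and `Re (1 + z S' / S) > 0`. Then a solution
of `T z + t z S z = c` moves towards the origin as `t` grows (`IsChainData.exists_branch`), so each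
map `T + t z S` is injective and their images increase with `t`.

If `a(0) = u(0)` but `a` leaves the image of `u`, Jack's lemma gives interior points with `a z = u
ζ`, `z a'(z) = m ζ u'(ζ)`, `m ≥ 1` and `‖z‖ < ‖ζ‖`. Thus `logExpr` of `a` at `z` is the chain of `u`
at time `m` and point `ζ`. Monotonicity of the chain and the Schwarz lemma then force `‖ζ‖ ≤ ‖z‖`, a
contradiction. Superordination is the same argument with time `1 / m`. -/

/-! ### Univalent functions and their inverses -/

/-- An injective analytic function has nonvanishing derivative. -/
theorem AnalyticAt.deriv_ne_zero_of_injOn {f : ℂ → ℂ} {U : Set ℂ} {z₀ : ℂ}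
    (hf : AnalyticAt ℂ f z₀) (hU : U ∈ 𝓝 z₀) (hinj : Set.InjOn f U) : deriv f z₀ ≠ 0 := by
  intro hd
  have hne : ¬ ∀ᶠ z in 𝓝 z₀, f z - f z₀ = 0 := by
    intro h
    have h2 : ∀ᶠ z in 𝓝[≠] z₀, False := by
      filter_upwards [nhdsWithin_le_nhds h, nhdsWithin_le_nhds hU, self_mem_nhdsWithin]
        with z hz hzU hzne
      exact hzne (hinj hzU (mem_of_mem_nhds hU) (sub_eq_zero.mp hz))
    exact (h2.exists).elim fun _ h => h
  have han : AnalyticAt ℂ (fun z => f z - f z₀) z₀ := hf.sub analyticAt_const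
  obtain ⟨n, g, hg, hg0, hfg⟩ := han.exists_eventuallyEq_pow_smul_nonzero_iff.mpr hne
  simp only [smul_eq_mul] at hfg
  have hn0 : n ≠ 0 := by
    rintro rfl
    have := hfg.self_of_nhds
    simp at this
    exact hg0 this.symm
  have hn1 : n ≠ 1 := by
    rintro rfl
    have h1 : HasDerivAt (fun z => (z - z₀) ^ 1 * g z) (g z₀) z₀ := by
      have h := (((hasDerivAt_id z₀).sub_const z₀).pow 1).mul hg.differentiableAt.hasDerivAt
      exact h.congr_deriv (by simp)
    have h2 : HasDerivAt (fun z => f z - f z₀) (deriv f z₀) z₀ :=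
      hf.differentiableAt.hasDerivAt.sub_const _
    have h3 := h2.unique (h1.congr_of_eventuallyEq hfg)
    exact hg0 (h3.symm.trans hd)
  -- an `n`-th root of `g` near `z₀`
  set k : ℂ → ℂ := fun z => g z₀ ^ (1 / n : ℂ) * (g z / g z₀) ^ (1 / n : ℂ) with hk
  have hkan : AnalyticAt ℂ k z₀ := by
    refine analyticAt_const.mul ?_
    refine (hg.div analyticAt_const hg0).cpow analyticAt_const ?_
    simp [div_self hg0]
  have hkn : ∀ z, k z ^ n = g z := by
    intro z
    simp only [hk, mul_pow, one_div]
    rw [Complex.cpow_nat_inv_pow _ hn0, Complex.cpow_nat_inv_pow _ hn0]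
    field_simp
  have hk0 : k z₀ ≠ 0 := by
    intro h
    have := hkn z₀
    rw [h, zero_pow hn0] at this
    exact hg0 this.symm
  set ψ : ℂ → ℂ := fun z => (z - z₀) * k z with hψ
  have hψan : AnalyticAt ℂ ψ z₀ := (analyticAt_id.sub analyticAt_const).mul hkan
  have hψ0 : ψ z₀ = 0 := by simp [hψ]
  have hψd : HasStrictDerivAt ψ (k z₀) z₀ := by
    have h1 : HasDerivAt ψ (k z₀) z₀ := by
      have h := ((hasDerivAt_id z₀).sub_const z₀).mul hkan.differentiableAt.hasDerivAt
      exact h.congr_deriv (by simp)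
    have := hψan.hasStrictDerivAt
    rwa [h1.deriv] at this
  have hmap := hψd.map_nhds_eq hk0
  rw [hψ0] at hmap
  have hV : {z | z ∈ U ∧ f z - f z₀ = (z - z₀) ^ n * g z} ∈ 𝓝 z₀ := by
    filter_upwards [hU, hfg] with z h1 h2 using ⟨h1, h2⟩
  have himg : ψ '' {z | z ∈ U ∧ f z - f z₀ = (z - z₀) ^ n * g z} ∈ 𝓝 (0 : ℂ) := by
    rw [← hmap]; exact image_mem_map hV
  -- Here `f - f z₀ = ψ ^ n` with `n ≥ 2` and `ψ` locally onto, so the points over `η` and `ω * η`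
  -- have the same image under `f`.
  set ω : ℂ := Complex.exp (2 * Real.pi * Complex.I / n) with hω
  have hprim := Complex.isPrimitiveRoot_exp n hn0
  have hω1 : ω ≠ 1 := hprim.ne_one (by omega)
  have hωn : ω ^ n = 1 := hprim.pow_eq_one
  have htend : Tendsto (fun η : ℂ => ω * η) (𝓝 0) (𝓝 0) := by
    have : Continuous fun η : ℂ => ω * η := by fun_prop
    simpa using this.tendsto 0
  have hev : ∀ᶠ η in 𝓝[≠] (0 : ℂ), False := by
    filter_upwards [nhdsWithin_le_nhds himg, nhdsWithin_le_nhds (htend himg),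
      self_mem_nhdsWithin] with η h1 h2 hη
    obtain ⟨x, ⟨hxU, hx⟩, hxη⟩ := h1
    obtain ⟨y, ⟨hyU, hy⟩, hyη⟩ := h2
    have e1 : f x - f z₀ = η ^ n := by rw [hx, ← hkn, ← mul_pow, ← hxη]
    have e2 : f y - f z₀ = η ^ n := by
      rw [hy, ← hkn, ← mul_pow]
      change ψ y ^ n = _
      rw [hyη, mul_pow, hωn, one_mul]
    have hxy : x = y := hinj hxU hyU (by linear_combination e1 - e2)
    have : η = ω * η := hxη.symm.trans (hxy ▸ hyη)
    have h3 : (ω - 1) * η = 0 := by linear_combination -this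
    rcases mul_eq_zero.mp h3 with h | h
    · exact hω1 (sub_eq_zero.mp h)
    · exact hη h
  exact (hev.exists).elim fun _ h => h

theorem UnivalentOnDisk.deriv_ne_zero {u : ℂ → ℂ} (hu : UnivalentOnDisk u) {z : ℂ}
    (hz : z ∈ unitDisk) : deriv u z ≠ 0 :=
  (hu.1 z hz).deriv_ne_zero_of_injOn (Metric.isOpen_ball.mem_nhds hz) hu.2

/-- The inverse of a univalent function. -/
theorem UnivalentOnDisk.exists_inverse {u : ℂ → ℂ} (hu : UnivalentOnDisk u) :
    ∃ v : ℂ → ℂ, AnalyticOnNhd ℂ v (u '' unitDisk) ∧ (∀ z ∈ unitDisk, v (u z) = z) ∧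
      IsOpen (u '' unitDisk) := by
  have hinv : ∀ z ∈ unitDisk, Function.invFunOn u unitDisk (u z) = z :=
    fun z hz => hu.2.leftInvOn_invFunOn hz
  refine ⟨Function.invFunOn u unitDisk, ?_, hinv, ?_⟩
  · rintro _ ⟨x, hx, rfl⟩
    have hd := hu.deriv_ne_zero hx
    refine ((hu.1 x hx).analyticAt_localInverse hd).congr ?_
    set r := (hu.1 x hx).hasStrictDerivAt.localInverse _ _ _ hd with hr
    have hrx : r (u x) = x := HasStrictFDerivAt.localInverse_apply_image ..
    have hrc : ContinuousAt r (u x) := ((hu.1 x hx).analyticAt_localInverse hd).continuousAt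
    have hrD : ∀ᶠ y in 𝓝 (u x), r y ∈ unitDisk :=
      hrc (by rw [hrx]; exact Metric.isOpen_ball.mem_nhds hx)
    filter_upwards [hrD, HasStrictDerivAt.eventually_right_inverse
      (hu.1 x hx).hasStrictDerivAt hd] with y hy1 hy2
    conv_rhs => rw [← hy2]
    exact (hinv _ hy1).symm
  · rw [isOpen_iff_mem_nhds]
    rintro _ ⟨x, hx, rfl⟩
    rw [← (hu.1 x hx).hasStrictDerivAt.map_nhds_eq (hu.deriv_ne_zero hx)]
    exact image_mem_map (Metric.isOpen_ball.mem_nhds hx)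

/-! ### Jack's lemma and contact points -/

/-- Along the ray in direction `d`, the real part of `h` starts at its largest possible value `1`,
so its one-sided slope is nonpositive. -/
theorem re_mul_deriv_nonpos {h : ℂ → ℂ} {h' d : ℂ} (hh : HasDerivAt h h' 0) (h0 : h 0 = 1)
    (hle : ∀ s : ℝ, 0 < s → ‖h (s * d)‖ ≤ 1) : (h' * d).re ≤ 0 := by
  have h1 : HasDerivAt (fun s : ℝ => (h ((s : ℂ) * d)).re) (h' * d).re 0 := by
    have e : HasDerivAt (fun s : ℂ => h (s * d)) (h' * d) ((0 : ℝ) : ℂ) := by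
      have a := (hasDerivAt_id ((0 : ℝ) : ℂ)).mul_const d
      refine HasDerivAt.comp (h₂ := h) ((0 : ℝ) : ℂ) ?_ (by simpa using a)
      simpa using hh
    exact e.real_of_complex
  have h2 := h1.hasDerivWithinAt (s := Set.Ioi 0)
  rw [hasDerivWithinAt_iff_tendsto_slope' (by simp)] at h2
  refine le_of_tendsto h2 ?_
  filter_upwards [self_mem_nhdsWithin] with s hs
  have hs' : (0 : ℝ) < s := hs
  rw [slope_def_field]
  refine div_nonpos_of_nonpos_of_nonneg ?_ (by linarith)
  have := (Complex.re_le_norm _).trans (hle s hs')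
  simp [h0]; linarith

/-- **Jack's lemma**. -/
theorem jack_lemma {ω : ℂ → ℂ} {z₀ : ℂ} {s : ℝ} (hω : DifferentiableOn ℂ ω (Metric.ball 0 s))
    (h0 : ω 0 = 0) (hz : z₀ ∈ Metric.ball (0 : ℂ) s) (hne : ω z₀ ≠ 0)
    (hmax : ∀ x, ‖x‖ ≤ ‖z₀‖ → ‖ω x‖ ≤ ‖ω z₀‖) :
    ∃ m : ℝ, 1 ≤ m ∧ z₀ * deriv ω z₀ = m * ω z₀ := by
  have hz0 : z₀ ≠ 0 := by rintro rfl; exact hne h0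
  have hr : 0 < ‖z₀‖ := norm_pos_iff.mpr hz0
  have hzs : ‖z₀‖ < s := by simpa using hz
  have hsch : ∀ x, ‖x‖ ≤ ‖z₀‖ → ‖ω x‖ ≤ ‖ω z₀‖ / ‖z₀‖ * ‖x‖ := by
    intro x hx
    rcases hx.lt_or_eq with hx | hx
    · have := Complex.dist_le_div_mul_dist_of_mapsTo_ball (f := ω) (c := 0) (R₁ := ‖z₀‖)
        (R₂ := ‖ω z₀‖) (z := x) (hω.mono (Metric.ball_subset_ball hzs.le)) (by
          intro y hy
          have hy' : ‖y‖ ≤ ‖z₀‖ := by simpa using (Metric.mem_ball.mp hy).le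
          simpa [h0] using hmax y hy') (by simpa using hx)
      simpa [h0] using this
    · rw [hx, div_mul_cancel₀ _ hr.ne']
      exact hmax x hx.le
  have hd : HasDerivAt ω (deriv ω z₀) z₀ :=
    (hω.differentiableAt (Metric.isOpen_ball.mem_nhds hz)).hasDerivAt
  set k : ℂ := z₀ * deriv ω z₀ / ω z₀ with hk
  -- In the logarithmic coordinate `x = exp τ * z₀`, the Schwarz bound `hsch` reads `‖h τ‖ ≤ 1` on
  -- the half-plane `Re τ ≤ 0`.
  set h : ℂ → ℂ := fun τ => ω (Complex.exp τ * z₀) * Complex.exp (-τ) / ω z₀ with hh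
  have hh0 : h 0 = 1 := by simp [hh, hne]
  have hhd : HasDerivAt h (k - 1) 0 := by
    have e1 : HasDerivAt (fun τ : ℂ => Complex.exp τ * z₀) z₀ 0 := by
      simpa using (Complex.hasDerivAt_exp 0).mul_const z₀
    have e2 : HasDerivAt (fun τ : ℂ => ω (Complex.exp τ * z₀)) (deriv ω z₀ * z₀) 0 := by
      refine HasDerivAt.comp (h₂ := ω) (0 : ℂ) ?_ e1
      simpa using hd
    have e3 : HasDerivAt (fun τ : ℂ => Complex.exp (-τ)) (-1) 0 := by
      simpa using (hasDerivAt_neg (0 : ℂ)).cexp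
    have e4 := (e2.mul e3).div_const (ω z₀)
    refine e4.congr_deriv ?_
    simp [hk]
    field_simp
    ring
  have hle : ∀ τ : ℂ, τ.re ≤ 0 → ‖h τ‖ ≤ 1 := by
    intro τ hτ
    have hx : ‖Complex.exp τ * z₀‖ = Real.exp τ.re * ‖z₀‖ := by
      rw [norm_mul, Complex.norm_exp]
    have hx1 : ‖Complex.exp τ * z₀‖ ≤ ‖z₀‖ := by
      rw [hx]
      exact mul_le_of_le_one_left hr.le (Real.exp_le_one_iff.mpr hτ)
    have h2 := hsch _ hx1
    rw [hx] at h2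
    have hne' : 0 < ‖ω z₀‖ := norm_pos_iff.mpr hne
    simp only [hh, norm_div, norm_mul, Complex.norm_exp, Complex.neg_re]
    rw [div_le_one hne', Real.exp_neg]
    rw [mul_inv_le_iff₀ (Real.exp_pos _)]
    calc _ ≤ _ := h2
      _ = _ := by field_simp
  -- Direction `-1` gives `Re k ≥ 1`; the directions `±I` give `Im k = 0`.
  have d1 := re_mul_deriv_nonpos (d := -1) hhd hh0 (fun s hs => hle _ (by simp [hs.le]))
  have d2 := re_mul_deriv_nonpos (d := Complex.I) hhd hh0 (fun s hs => hle _ (by simp))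
  have d3 := re_mul_deriv_nonpos (d := -Complex.I) hhd hh0 (fun s hs => hle _ (by simp))
  simp at d1 d2 d3
  refine ⟨k.re, by linarith, ?_⟩
  have hkr : ((k.re : ℝ) : ℂ) = k := Complex.ext (by simp) (by simp; linarith)
  rw [hkr, hk, div_mul_cancel₀ _ hne]

/-- If an analytic function leaves the image of a univalent function with the same value at the
origin, there is a point where the boundary contact relation holds. -/
theorem UnivalentOnDisk.exists_contact {u a : ℂ → ℂ} (hu : UnivalentOnDisk u)
    (ha : AnalyticOnNhd ℂ a unitDisk) (h0 : a 0 = u 0)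
    (hnot : ¬ Set.MapsTo a unitDisk (u '' unitDisk)) :
    ∃ z₀ ∈ unitDisk, ∃ ζ ∈ unitDisk, ∃ m : ℝ, 1 ≤ m ∧ ‖z₀‖ < ‖ζ‖ ∧ a z₀ = u ζ ∧
      z₀ * deriv a z₀ = m * (ζ * deriv u ζ) := by
  obtain ⟨v, hv, hvu, hopen⟩ := hu.exists_inverse
  have h0D : (0 : ℂ) ∈ unitDisk := by simp
  obtain ⟨z₁, hz₁, hz₁'⟩ : ∃ z ∈ unitDisk, a z ∉ u '' unitDisk := by
    simpa [Set.MapsTo] using hnot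
  have hcb : Metric.closedBall (0 : ℂ) ‖z₁‖ ⊆ unitDisk :=
    Metric.closedBall_subset_ball (by simpa using hz₁)
  have hKc : IsCompact (Metric.closedBall (0 : ℂ) ‖z₁‖ ∩ a ⁻¹' (u '' unitDisk)ᶜ) := by
    refine (isCompact_closedBall _ _).of_isClosed_subset ?_ Set.inter_subset_left
    exact (ha.continuousOn.mono hcb).preimage_isClosed_of_isClosed Metric.isClosed_closedBall
      hopen.isClosed_compl
  -- `z₂` is an exit point of least modulus `s`, so `v ∘ a` is analytic on the ball of radius `s`.
  obtain ⟨z₂, ⟨hz₂, hz₂'⟩, hmin⟩ := hKc.exists_isMinOn ⟨z₁, by simp, hz₁'⟩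
    (continuous_norm.continuousOn)
  have hz₂D := hcb hz₂
  set s := ‖z₂‖ with hs
  have hs1 : s < 1 := by simpa using hz₂D
  have hin : ∀ x : ℂ, ‖x‖ < s → a x ∈ u '' unitDisk := by
    intro x hx
    by_contra hcon
    have hx1 : ‖x‖ ≤ ‖z₁‖ := hx.le.trans (by simpa using hz₂)
    exact absurd (hmin ⟨by simpa using hx1, hcon⟩) (not_le.mpr hx)
  set ω : ℂ → ℂ := fun z => v (a z) with hω
  have hωD : ∀ x : ℂ, ‖x‖ < s → ω x ∈ unitDisk ∧ u (ω x) = a x := by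
    intro x hx
    obtain ⟨y, hy, hya⟩ := hin x hx
    have : ω x = y := by simp only [hω]; rw [← hya, hvu y hy]
    rw [this]; exact ⟨hy, hya⟩
  have hωan : ∀ x : ℂ, ‖x‖ < s → AnalyticAt ℂ ω x := fun x hx =>
    (hv _ (hin x hx)).comp (ha x (by simp; linarith))
  have hω0 : ω 0 = 0 := by simp only [hω]; rw [h0, hvu 0 h0D]
  have hspos : 0 < s := by
    rw [hs, norm_pos_iff]
    rintro rfl
    exact hz₂' (by rw [h0]; exact ⟨0, h0D, rfl⟩)
  -- Otherwise `a` maps the ball of radius `s` into the compact image of the closed ball under `u`,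
  -- and by continuity `a z₂` lies there too.
  obtain ⟨x, hx, hxs⟩ : ∃ x : ℂ, ‖x‖ < s ∧ s < ‖ω x‖ := by
    by_contra! hcon
    have hcomp : IsCompact (u '' Metric.closedBall (0 : ℂ) s) :=
      (isCompact_closedBall _ _).image_of_continuousOn
        (hu.1.continuousOn.mono (Metric.closedBall_subset_ball hs1))
    have hmaps : Set.MapsTo a (Metric.ball 0 s) (u '' Metric.closedBall (0 : ℂ) s) := by
      intro y hy
      have hy' : ‖y‖ < s := by simpa using hy
      exact ⟨ω y, by simpa using hcon y hy', (hωD y hy').2⟩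
    have hcl : z₂ ∈ closure (Metric.ball (0 : ℂ) s) := by
      rw [closure_ball _ hspos.ne']; simp [hs]
    have hmem : a z₂ ∈ closure (u '' Metric.closedBall (0 : ℂ) s) :=
      ((ha z₂ hz₂D).continuousAt.continuousWithinAt.mem_closure hcl hmaps)
    rw [hcomp.isClosed.closure_eq] at hmem
    exact hz₂' (Set.image_mono (Metric.closedBall_subset_ball hs1) hmem)
  have hsub : ∀ y : ℂ, ‖y‖ ≤ ‖x‖ → ‖y‖ < s := fun y hy => hy.trans_lt hx
  obtain ⟨z₀, hz₀, hmax⟩ := (isCompact_closedBall (0 : ℂ) ‖x‖).exists_isMaxOn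
    ⟨0, by simp⟩ (f := fun y => ‖ω y‖) (fun y (hy : y ∈ Metric.closedBall (0 : ℂ) ‖x‖) =>
      (hωan y (hsub y (by simpa using hy))).continuousAt.norm.continuousWithinAt)
  have hz₀x : ‖z₀‖ ≤ ‖x‖ := by simpa using hz₀
  have hz₀s := hsub z₀ hz₀x
  have hbig : s < ‖ω z₀‖ := hxs.trans_le (hmax (by simp))
  have hz₀D : z₀ ∈ unitDisk := by simp; linarith
  obtain ⟨m, hm, hmeq⟩ := jack_lemma (s := s) (ω := ω) (z₀ := z₀)
    (fun y hy => (hωan y (by simpa using hy)).differentiableAt.differentiableWithinAt)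
    hω0 (by simpa using hz₀s) (norm_pos_iff.mp (hspos.trans hbig))
    (fun y hy => hmax (by simpa using hy.trans hz₀x))
  refine ⟨z₀, hz₀D, ω z₀, (hωD z₀ hz₀s).1, m, hm, hz₀s.trans hbig, (hωD z₀ hz₀s).2.symm, ?_⟩
  have hev : a =ᶠ[𝓝 z₀] fun z => u (ω z) := by
    have : Metric.ball (0 : ℂ) s ∈ 𝓝 z₀ := Metric.isOpen_ball.mem_nhds (by simpa using hz₀s)
    filter_upwards [this] with y hy
    exact (hωD y (by simpa using hy)).2.symm
  have hda : deriv a z₀ = deriv u (ω z₀) * deriv ω z₀ := by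
    rw [hev.deriv_eq]
    exact ((hu.1 _ (hωD z₀ hz₀s).1).differentiableAt.hasDerivAt.comp z₀
      (hωan z₀ hz₀s).differentiableAt.hasDerivAt).deriv
  rw [hda]
  linear_combination deriv u (ω z₀) * hmeq

/-! ### Equality from moduli, and analytic logarithms -/

/-- Analytic functions in the disk of equal modulus that agree at the origin are equal. -/
theorem eqOn_unitDisk_of_norm_eq {F G : ℂ → ℂ} (hF : AnalyticOnNhd ℂ F unitDisk)
    (hG : AnalyticOnNhd ℂ G unitDisk) (h0 : F 0 = G 0) (hne : G 0 ≠ 0)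
    (hnorm : ∀ z ∈ unitDisk, ‖F z‖ = ‖G z‖) : Set.EqOn F G unitDisk := by
  have h0D : (0 : ℂ) ∈ unitDisk := by simp
  have hD : unitDisk ∈ 𝓝 (0 : ℂ) := Metric.isOpen_ball.mem_nhds h0D
  refine hF.eqOn_of_preconnected_of_eventuallyEq hG (convex_ball 0 1).isPreconnected h0D ?_
  have hGne : ∀ᶠ z in 𝓝 (0 : ℂ), G z ≠ 0 := (hG 0 h0D).continuousAt.eventually_ne hne
  have han : ∀ᶠ z in 𝓝 (0 : ℂ), DifferentiableAt ℂ (fun z => F z / G z) z := by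
    filter_upwards [hGne, hD] with z hz hzD
    exact (hF z hzD).differentiableAt.div (hG z hzD).differentiableAt hz
  -- The quotient has modulus `1` near the origin, so the maximum principle makes it constant.
  have hmax : IsLocalMax (norm ∘ fun z => F z / G z) 0 := by
    filter_upwards [hGne, hD] with z hz hzD
    simp [hnorm z hzD, hz, h0, hne]
  filter_upwards [Complex.eventually_eq_of_isLocalMax_norm han hmax, hGne] with z hz hzG
  rw [h0, div_self hne, div_eq_one_iff_eq hzG] at hz
  exact hz

/-- A zero-free analytic function in the disk has an analytic logarithm. -/
theorem exists_log_unitDisk {p : ℂ → ℂ} (hp : AnalyticOnNhd ℂ p unitDisk)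
    (hne : ∀ z ∈ unitDisk, p z ≠ 0) (h0 : p 0 = 1) :
    ∃ u : ℂ → ℂ, AnalyticOnNhd ℂ u unitDisk ∧ u 0 = 0 ∧
      ∀ z ∈ unitDisk, Complex.exp (u z) = p z := by
  have h0D : (0 : ℂ) ∈ unitDisk := by simp
  have hdiff : DifferentiableOn ℂ (fun z => deriv p z / p z) unitDisk := fun z hz =>
    ((hp.deriv z hz).div (hp z hz) (hne z hz)).differentiableAt.differentiableWithinAt
  obtain ⟨u, hu0, hu⟩ := hdiff.isExactOn_ball.with_val_at 0 0
  refine ⟨u, ?_, hu0, ?_⟩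
  · refine DifferentiableOn.analyticOnNhd (fun z hz => ?_) Metric.isOpen_ball
    exact (hu z hz).differentiableAt.differentiableWithinAt
  · intro z hz
    have hc : ∀ x ∈ unitDisk, HasDerivWithinAt (fun z => p z * Complex.exp (-u z)) 0 unitDisk x := by
      intro x hx
      have h := ((hp x hx).differentiableAt.hasDerivAt.mul (hu x hx).neg.cexp)
      refine (h.congr_deriv ?_).hasDerivWithinAt
      field_simp [hne x hx]
      ring
    have h1 := (convex_ball (0 : ℂ) 1).is_const_of_fderivWithin_eq_zero (𝕜 := ℂ)
      (f := fun z => p z * Complex.exp (-u z))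
      (fun x hx => (hc x hx).differentiableWithinAt)
      (fun x hx => by
        have := (hc x hx).hasFDerivWithinAt.fderivWithin
          (Metric.isOpen_ball.uniqueDiffWithinAt hx)
        rw [this]; ext; simp) hz h0D
    simp only [h0, hu0, neg_zero, Complex.exp_zero, mul_one, Complex.exp_neg] at h1
    rw [← div_eq_mul_inv, div_eq_one_iff_eq (Complex.exp_ne_zero _)] at h1
    exact h1.symm

/-! ### The subordination chain -/

/-- The conditions under which `T + t z S`, `0 ≤ t`, is a subordination chain. -/
structure IsChainData (T S : ℂ → ℂ) : Prop where
  analytic_left : AnalyticOnNhd ℂ T unitDisk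
  analytic_right : AnalyticOnNhd ℂ S unitDisk
  ne_zero : ∀ z ∈ unitDisk, S z ≠ 0
  re_left : ∀ z ∈ unitDisk, 0 < (deriv T z / S z).re
  re_right : ∀ z ∈ unitDisk, 0 < (1 + z * deriv S z / S z).re

/-- The pencil whose zeros at parameter `t / (1 + t)` are the solutions of `T z + t z S z = c`. -/
def chainPencil (T S : ℂ → ℂ) (c : ℂ) (x : ℂ × ℂ) : ℂ :=
  (1 - x.1) * (T x.2 - c) + x.1 * (x.2 * S x.2)

namespace IsChainData

variable {T S : ℂ → ℂ} {c : ℂ}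

theorem continuousAt_chainPencil (h : IsChainData T S) {x : ℂ × ℂ} (hx : x.2 ∈ unitDisk) :
    ContinuousAt (chainPencil T S c) x := by
  have h1 : ContinuousAt (fun y : ℂ × ℂ => T y.2) x :=
    (h.analytic_left _ hx).continuousAt.comp continuousAt_snd
  have h2 : ContinuousAt (fun y : ℂ × ℂ => S y.2) x :=
    (h.analytic_right _ hx).continuousAt.comp continuousAt_snd
  exact ((continuousAt_const.sub continuousAt_fst).mul (h1.sub continuousAt_const)).add
    (continuousAt_fst.mul (continuousAt_snd.mul h2))

/-- The solution branch of the pencil through a zero, with its derivative. -/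
theorem exists_branch (h : IsChainData T S) {s : ℝ} (hs0 : 0 ≤ s) (hs1 : s ≤ 1) {z : ℂ}
    (hz : z ∈ unitDisk) (h0 : chainPencil T S c (s, z) = 0) :
    ∃ (ψ : ℂ → ℂ) (ψ' : ℂ), ψ s = z ∧ HasDerivAt ψ ψ' s ∧
      (∀ᶠ x in 𝓝 ((s : ℂ), z), chainPencil T S c x = 0 ↔ ψ x.1 = x.2) ∧
      (s < 1 → z ≠ 0 → (starRingEnd ℂ z * ψ').re < 0) := by
  set A : ℂ := deriv T z / S z with hA
  set B : ℂ := 1 + z * deriv S z / S z with hB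
  have hSne := h.ne_zero z hz
  have hAre := h.re_left z hz
  have hBre := h.re_right z hz
  rw [← hA] at hAre
  rw [← hB] at hBre
  -- The derivative of the pencil in `z` is `S z * M`; as a convex combination of `A` and `B`, `M`
  -- has positive real part.
  set M : ℂ := (1 - s) * A + s * B with hM
  have hMre : 0 < M.re := by
    have : M.re = (1 - s) * A.re + s * B.re := by simp [hM]
    rw [this]
    rcases hs1.lt_or_eq with h1 | h1
    · have := mul_pos (sub_pos.mpr h1) hAre
      have := mul_nonneg hs0 hBre.le
      linarith
    · subst h1; simpa using hBre
  have hMne : M ≠ 0 := by rintro h; simp [h] at hMre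
  set q : ℂ := z * S z - (T z - c) with hq
  have hTd := (h.analytic_left z hz).hasStrictDerivAt
  have hSd := (h.analytic_right z hz).hasStrictDerivAt
  set u : ℂ × ℂ := ((s : ℂ), z) with hu
  set f' : ℂ × ℂ →L[ℂ] ℂ :=
    q • ContinuousLinearMap.fst ℂ ℂ ℂ + (S z * M) • ContinuousLinearMap.snd ℂ ℂ ℂ with hf'
  have hfst : HasStrictFDerivAt (fun x : ℂ × ℂ => x.1) (ContinuousLinearMap.fst ℂ ℂ ℂ) u :=
    hasStrictFDerivAt_fst
  have hsnd : HasStrictFDerivAt (fun x : ℂ × ℂ => x.2) (ContinuousLinearMap.snd ℂ ℂ ℂ) u :=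
    hasStrictFDerivAt_snd
  have hF : HasStrictFDerivAt (chainPencil T S c) f' u := by
    have hT2 : HasStrictFDerivAt (fun x : ℂ × ℂ => T x.2) _ u := hTd.hasStrictFDerivAt.comp u hsnd
    have hS2 : HasStrictFDerivAt (fun x : ℂ × ℂ => S x.2) _ u := hSd.hasStrictFDerivAt.comp u hsnd
    have e := ((hfst.const_sub 1).mul (hT2.sub_const c)).add (hfst.mul (hsnd.mul hS2))
    refine e.congr_fderiv ?_
    ext
    · simp [hf', hu, hq]; ring
    · simp [hf', hu, hM, hA, hB]; field_simp; ring
  have hinr : f' ∘L .inr ℂ ℂ ℂ =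
      (ContinuousLinearEquiv.unitsEquivAut ℂ (.mk0 (S z * M) (mul_ne_zero hSne hMne)) :
        ℂ →L[ℂ] ℂ) := by
    ext; simp [hf']
  have hinv : (f' ∘L .inr ℂ ℂ ℂ).IsInvertible := ⟨_, hinr.symm⟩
  set ψ := hF.implicitFunctionOfProdDomain hinv with hψ
  have hiff := hF.eventually_apply_eq_iff_implicitFunctionOfProdDomain hinv
  have hder := (hF.hasStrictFDerivAt_implicitFunctionOfProdDomain hinv).hasFDerivAt.hasDerivAt
  have hψs : ψ s = z := (hiff.self_of_nhds).mp rfl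
  refine ⟨ψ, _, hψs, hder, ?_, ?_⟩
  · filter_upwards [hiff] with x hx
    rwa [h0] at hx
  · intro hs hzne
    have hval : (-(f' ∘L .inr ℂ ℂ ℂ).inverse ∘L (f' ∘L .inl ℂ ℂ ℂ)) 1 = -(q / (S z * M)) := by
      rw [hinr, ContinuousLinearMap.inverse_equiv]
      simp [hf', div_eq_mul_inv, mul_comm]
    rw [hval]
    have hs' : (1 - s : ℂ) ≠ 0 := by
      have : ((1 - s : ℝ) : ℂ) ≠ 0 := by exact_mod_cast (sub_pos.mpr hs).ne'
      simpa using this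
    have hqv : q = z * S z / (1 - s) := by
      rw [eq_div_iff hs', hq]
      simp only [chainPencil] at h0
      linear_combination (-1) * h0
    -- The pencil equation turns `q` into `z S z / (1 - s)`, so `ψ' = -z / ((1 - s) M)`, which
    -- points inward.
    have hfin : starRingEnd ℂ z * -(q / (S z * M)) = -(((‖z‖ ^ 2 / (1 - s) : ℝ) : ℂ) * M⁻¹) := by
      push_cast
      rw [← Complex.conj_mul', hqv]
      field_simp
    rw [hfin, Complex.neg_re, Complex.re_ofReal_mul, neg_lt_zero]
    refine mul_pos (div_pos (by positivity) (by linarith)) ?_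
    rw [Complex.inv_re]
    exact div_pos hMre (Complex.normSq_pos.mpr hMne)

/-- Zeros of the pencil move towards the origin as the parameter increases. -/
theorem exists_branch_norm_le (h : IsChainData T S) {s : ℝ} (hs0 : 0 ≤ s) (hs1 : s < 1) {z : ℂ}
    (hz : z ∈ unitDisk) (h0 : chainPencil T S c (s, z) = 0) :
    ∃ ψ : ℂ → ℂ, ψ s = z ∧ ContinuousAt ψ s ∧
      (∀ᶠ t : ℝ in 𝓝[>] s, chainPencil T S c (t, ψ t) = 0 ∧ ‖ψ t‖ ≤ ‖z‖) := by
  obtain ⟨ψ, ψ', hψs, hder, hiff, hneg⟩ := h.exists_branch hs0 hs1.le hz h0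
  refine ⟨ψ, hψs, hder.continuousAt, ?_⟩
  have hcast : Tendsto (fun t : ℝ => (t : ℂ)) (𝓝[>] s) (𝓝 (s : ℂ)) :=
    (Complex.continuous_ofReal.tendsto s).mono_left nhdsWithin_le_nhds
  have hψt : Tendsto (fun t : ℝ => ψ t) (𝓝[>] s) (𝓝 z) := by
    have := hder.continuousAt.tendsto.comp hcast
    rwa [hψs] at this
  have hzero : ∀ᶠ t : ℝ in 𝓝[>] s, chainPencil T S c (t, ψ t) = 0 := by
    have : Tendsto (fun t : ℝ => ((t : ℂ), ψ t)) (𝓝[>] s) (𝓝 ((s : ℂ), z)) :=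
      hcast.prodMk_nhds hψt
    filter_upwards [this.eventually hiff] with t ht
    exact ht.mpr rfl
  refine hzero.and ?_
  -- At the origin the derivative of the squared norm gives no sign. But then `c = T 0`, so `0` is a
  -- zero for every parameter and the branch stays there.
  by_cases hz0 : z = 0
  · subst hz0
    have hs' : (1 - s : ℂ) ≠ 0 := by
      have : ((1 - s : ℝ) : ℂ) ≠ 0 := by exact_mod_cast (sub_pos.mpr hs1).ne'
      simpa using this
    have hc : T 0 - c = 0 := by simpa [chainPencil, hs'] using h0
    have : Tendsto (fun t : ℝ => ((t : ℂ), (0 : ℂ))) (𝓝[>] s) (𝓝 ((s : ℂ), 0)) :=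
      hcast.prodMk_nhds tendsto_const_nhds
    filter_upwards [this.eventually hiff] with t ht
    have := ht.mp (by simp [chainPencil, hc])
    simp [show ψ t = 0 from this]
  · have hψr : HasDerivAt (fun t : ℝ => ψ t) ψ' s := hder.comp_ofReal
    have hsq := hψr.norm_sq
    have hdneg : 2 * inner ℝ (ψ s) ψ' < 0 := by
      rw [hψs, Complex.inner]
      have := hneg hs1 hz0
      rw [mul_comm] at this
      linarith
    have h2 := hsq.hasDerivWithinAt (s := Set.Ioi s)
    rw [hasDerivWithinAt_iff_tendsto_slope' (by simp)] at h2
    filter_upwards [h2.eventually_lt_const hdneg, self_mem_nhdsWithin] with t ht hts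
    have hts' : s < t := hts
    rw [slope_def_field, div_neg_iff] at ht
    rcases ht with ht | ht
    · linarith [ht.2]
    · have := ht.1
      simp only [hψs] at this
      exact (sq_le_sq₀ (norm_nonneg _) (norm_nonneg _)).mp (by linarith)

/-- A zero of the pencil can be continued to all larger parameters. -/
theorem exists_zero_of_le (h : IsChainData T S) {s t : ℝ} (hs0 : 0 ≤ s) (hst : s ≤ t) (ht1 : t ≤ 1)
    {z : ℂ} (hz : z ∈ unitDisk) (h0 : chainPencil T S c (s, z) = 0) :
    ∃ v : ℂ, ‖v‖ ≤ ‖z‖ ∧ chainPencil T S c (t, v) = 0 := by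
  have hcb : Metric.closedBall (0 : ℂ) ‖z‖ ⊆ unitDisk :=
    Metric.closedBall_subset_ball (by simpa using hz)
  set E : Set ℝ := {x | ∃ v : ℂ, ‖v‖ ≤ ‖z‖ ∧ chainPencil T S c (x, v) = 0} with hE
  have hclosed : IsClosed (E ∩ Set.Icc s t) := by
    set K : Set (ℝ × ℂ) := Set.Icc s t ×ˢ Metric.closedBall (0 : ℂ) ‖z‖ with hK
    have hKc : IsCompact K := isCompact_Icc.prod (isCompact_closedBall _ _)
    have hcont : ContinuousOn (fun x : ℝ × ℂ => chainPencil T S c ((x.1 : ℂ), x.2)) K := by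
      intro x hx
      refine ContinuousAt.continuousWithinAt ?_
      refine ContinuousAt.comp (g := chainPencil T S c)
        (h.continuousAt_chainPencil (hcb hx.2)) ?_
      fun_prop
    have hZ := hKc.of_isClosed_subset
      (hcont.preimage_isClosed_of_isClosed hKc.isClosed (isClosed_singleton (x := (0 : ℂ))))
      Set.inter_subset_left
    have himg := (hZ.image continuous_fst).isClosed
    convert himg using 1
    ext x
    constructor
    · rintro ⟨⟨v, hv, hv0⟩, hx⟩
      exact ⟨(x, v), ⟨⟨hx, by simpa using hv⟩, hv0⟩, rfl⟩
    · rintro ⟨⟨x', v⟩, ⟨⟨hx, hv⟩, hv0⟩, rfl⟩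
      exact ⟨⟨v, by simpa using hv, hv0⟩, hx⟩
  -- Continuous induction: `E` is closed in the interval, and `exists_branch_norm_le` extends it to
  -- the right of each of its points below `t`.
  refine hclosed.Icc_subset_of_forall_exists_gt ⟨z, le_rfl, h0⟩ ?_ (Set.right_mem_Icc.mpr hst)
  rintro x ⟨⟨v, hv, hv0⟩, hxs, hxt⟩ y hy
  obtain ⟨ψ, -, -, hev⟩ := h.exists_branch_norm_le (hs0.trans hxs) (hxt.trans_le ht1)
    (hcb (by simpa using hv)) hv0
  obtain ⟨τ, ⟨h1, h2⟩, h3⟩ := (hev.and (Ioc_mem_nhdsGT hy)).exists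
  exact ⟨τ, ⟨ψ τ, h2.trans hv, h1⟩, h3⟩

/-- The zeros of the pencil in the disk are unique. -/
theorem zero_unique (h : IsChainData T S) {s : ℝ} (hs0 : 0 ≤ s) (hs1 : s ≤ 1)
    {v w : ℂ} (hv : v ∈ unitDisk) (hw : w ∈ unitDisk) (hv0 : chainPencil T S c (s, v) = 0)
    (hw0 : chainPencil T S c (s, w) = 0) : v = w := by
  by_contra hne
  set r : ℝ := max ‖v‖ ‖w‖ with hr
  have hr1 : r < 1 := max_lt (by simpa using hv) (by simpa using hw)
  have hcb : Metric.closedBall (0 : ℂ) r ⊆ unitDisk := Metric.closedBall_subset_ball hr1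
  set E : Set ℝ := {x | ∃ a b : ℂ, ‖a‖ ≤ r ∧ ‖b‖ ≤ r ∧ a ≠ b ∧
    chainPencil T S c (x, a) = 0 ∧ chainPencil T S c (x, b) = 0} with hE
  have hclosed : IsClosed (E ∩ Set.Icc s 1) := by
    set K : Set (ℝ × ℂ × ℂ) :=
      Set.Icc s 1 ×ˢ Metric.closedBall (0 : ℂ) r ×ˢ Metric.closedBall (0 : ℂ) r with hK
    have hKc : IsCompact K :=
      isCompact_Icc.prod ((isCompact_closedBall _ _).prod (isCompact_closedBall _ _))
    have hcont : ContinuousOn (fun x : ℝ × ℂ × ℂ => (chainPencil T S c ((x.1 : ℂ), x.2.1),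
        chainPencil T S c ((x.1 : ℂ), x.2.2))) K := by
      intro x hx
      refine ContinuousAt.continuousWithinAt ?_
      refine ContinuousAt.prodMk ?_ ?_
      · refine ContinuousAt.comp (g := chainPencil T S c)
          (h.continuousAt_chainPencil (hcb hx.2.1)) ?_
        fun_prop
      · refine ContinuousAt.comp (g := chainPencil T S c)
          (h.continuousAt_chainPencil (hcb hx.2.2)) ?_
        fun_prop
    set Z := K ∩ (fun x : ℝ × ℂ × ℂ => (chainPencil T S c ((x.1 : ℂ), x.2.1),
        chainPencil T S c ((x.1 : ℂ), x.2.2))) ⁻¹' {0} with hZdef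
    have hZ : IsCompact Z := hKc.of_isClosed_subset
      (hcont.preimage_isClosed_of_isClosed hKc.isClosed isClosed_singleton)
      Set.inter_subset_left
    -- Distinct zeros could merge in a limit. Local uniqueness of the branch puts every diagonal
    -- point of `Z` into the open set `W`, so the pairs of distinct zeros form the compact set `Z \
    -- W`.
    set W : Set (ℝ × ℂ × ℂ) := {x | ∀ᶠ y in 𝓝 x, y ∈ Z → y.2.1 = y.2.2} with hW
    have hWo : IsOpen W := isOpen_setOfPred_eventually_nhds
    have himg := ((hZ.diff hWo).image continuous_fst).isClosed
    convert himg using 1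
    ext x
    constructor
    · rintro ⟨⟨a, b, ha, hb, hab, ha0, hb0⟩, hx⟩
      have hmem : (x, a, b) ∈ Z := ⟨⟨hx, by simpa using ha, by simpa using hb⟩, by simp [ha0, hb0]⟩
      exact ⟨(x, a, b), ⟨hmem, fun hcon => hab (hcon.self_of_nhds hmem)⟩, rfl⟩
    · rintro ⟨⟨x', a, b⟩, ⟨⟨⟨hx, ha, hb⟩, hab0⟩, hnW⟩, rfl⟩
      have h2 : chainPencil T S c ((x' : ℂ), a) = 0 ∧ chainPencil T S c ((x' : ℂ), b) = 0 := by
        simpa using hab0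
      refine ⟨⟨a, b, by simpa using ha, by simpa using hb, ?_, h2.1, h2.2⟩, hx⟩
      rintro rfl
      refine hnW ?_
      obtain ⟨ψ, ψ', -, -, hiff, -⟩ := h.exists_branch (hs0.trans hx.1) hx.2 (hcb ha) h2.1
      have c1 : Tendsto (fun y : ℝ × ℂ × ℂ => ((y.1 : ℂ), y.2.1)) (𝓝 (x', a, a))
          (𝓝 ((x' : ℂ), a)) := by
        have : Continuous (fun y : ℝ × ℂ × ℂ => ((y.1 : ℂ), y.2.1)) := by fun_prop
        exact this.tendsto _
      have c2 : Tendsto (fun y : ℝ × ℂ × ℂ => ((y.1 : ℂ), y.2.2)) (𝓝 (x', a, a))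
          (𝓝 ((x' : ℂ), a)) := by
        have : Continuous (fun y : ℝ × ℂ × ℂ => ((y.1 : ℂ), y.2.2)) := by fun_prop
        exact this.tendsto _
      change ∀ᶠ y in 𝓝 (x', a, a), y ∈ Z → y.2.1 = y.2.2
      filter_upwards [c1.eventually hiff, c2.eventually hiff] with y hy1 hy2 hyZ
      have h3 : chainPencil T S c ((y.1 : ℂ), y.2.1) = 0 ∧
          chainPencil T S c ((y.1 : ℂ), y.2.2) = 0 := by
        simpa using hyZ.2
      exact (hy1.mp h3.1).symm.trans (hy2.mp h3.2)
  have hall := hclosed.Icc_subset_of_forall_exists_gt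
    ⟨v, w, le_max_left _ _, le_max_right _ _, hne, hv0, hw0⟩ (by
      rintro x ⟨⟨a, b, ha, hb, hab, ha0, hb0⟩, hxs, hx1⟩ y hy
      obtain ⟨ψ, hψ, hψc, hψe⟩ := h.exists_branch_norm_le (hs0.trans hxs) hx1
        (hcb (by simpa using ha)) ha0
      obtain ⟨φ, hφ, hφc, hφe⟩ := h.exists_branch_norm_le (hs0.trans hxs) hx1
        (hcb (by simpa using hb)) hb0
      have hcast : Tendsto (fun t : ℝ => (t : ℂ)) (𝓝[>] x) (𝓝 (x : ℂ)) :=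
        (Complex.continuous_ofReal.tendsto x).mono_left nhdsWithin_le_nhds
      have hneq : ∀ᶠ t : ℝ in 𝓝[>] x, ψ t ≠ φ t :=
        hcast.eventually (hψc.ne_iff_eventually_ne hφc |>.mp (by rwa [hψ, hφ]))
      obtain ⟨τ, ⟨⟨⟨h1, h2⟩, h3, h4⟩, h5⟩, h6⟩ :=
        (((hψe.and hφe).and hneq).and (Ioc_mem_nhdsGT hy)).exists
      exact ⟨τ, ⟨ψ τ, φ τ, h2.trans ha, h4.trans hb, h5, h1, h3⟩, h6⟩)
    (Set.right_mem_Icc.mpr hs1)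
  obtain ⟨a, b, ha, hb, hab, ha0, hb0⟩ := hall
  -- Two distinct zeros have been carried to parameter `1`, where the pencil is `x * S x` and
  -- vanishes in the disk only at `0`.
  have hzero : ∀ x : ℂ, ‖x‖ ≤ r → chainPencil T S c (((1 : ℝ) : ℂ), x) = 0 → x = 0 := by
    intro x hx hx0
    have := h.ne_zero x (hcb (by simpa using hx))
    simpa [chainPencil, this] using hx0
  exact hab ((hzero a ha ha0).trans (hzero b hb hb0).symm)

/-- Dividing the equation by `1 + t` moves the times `[0, ∞)` to `[0, 1)`; the pencil also makes
sense at the added endpoint `1`. -/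
theorem chainPencil_eq_zero_iff {t : ℝ} (ht : 0 ≤ t) (z : ℂ) :
    chainPencil T S c ((t / (1 + t) : ℝ), z) = 0 ↔ T z + t * (z * S z) = c := by
  have h1 : (1 + t : ℂ) ≠ 0 := by
    have : ((1 + t : ℝ) : ℂ) ≠ 0 := by exact_mod_cast (by linarith : (0 : ℝ) < 1 + t).ne'
    simpa using this
  have : chainPencil T S c ((t / (1 + t) : ℝ), z) = (T z + t * (z * S z) - c) / (1 + t) := by
    simp only [chainPencil]
    push_cast
    field_simp
    ring
  rw [this, div_eq_zero_iff, or_iff_left h1, sub_eq_zero]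

/-- This is the monotonicity of the chain, with control of the modulus: the image of each closed
disk about `0` grows with time. -/
theorem exists_eq_of_le (h : IsChainData T S) {s t : ℝ} (hs : 0 ≤ s) (hst : s ≤ t) {z : ℂ}
    (hz : z ∈ unitDisk) :
    ∃ v : ℂ, ‖v‖ ≤ ‖z‖ ∧ T v + t * (v * S v) = T z + s * (z * S z) := by
  have ht := hs.trans hst
  obtain ⟨v, hv, hv0⟩ := h.exists_zero_of_le (c := T z + s * (z * S z)) (s := s / (1 + s))
    (t := t / (1 + t)) (by positivity) (by
      rw [div_le_div_iff₀ (by linarith) (by linarith)]; nlinarith)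
    (by rw [div_le_one (by linarith)]; linarith) hz ((chainPencil_eq_zero_iff hs z).mpr rfl)
  exact ⟨v, hv, (chainPencil_eq_zero_iff ht v).mp hv0⟩

theorem injOn (h : IsChainData T S) {t : ℝ} (ht : 0 ≤ t) :
    Set.InjOn (fun z => T z + t * (z * S z)) unitDisk := by
  intro v hv w hw hvw
  exact h.zero_unique (c := T w + t * (w * S w)) (s := t / (1 + t)) (by positivity)
    (by rw [div_le_one (by linarith)]; linarith) hv hw
    ((chainPencil_eq_zero_iff ht v).mpr hvw) ((chainPencil_eq_zero_iff ht w).mpr rfl)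

end IsChainData

/-! ### Differential subordination and superordination in logarithmic form -/

/-- `q ^ (b + 1)` in terms of a logarithm `u` of `q`. -/
noncomputable def logChainLeft (b : ℝ) (u : ℂ → ℂ) (z : ℂ) : ℂ :=
  Complex.exp ((b + 1) * u z)

/-- `l q' q ^ (b - 1)` in terms of a logarithm `u` of `q`. -/
noncomputable def logChainRight (b : ℝ) (l : ℂ) (u : ℂ → ℂ) (z : ℂ) : ℂ :=
  l * deriv u z * Complex.exp (b * u z)

/-- `q ^ (b + 1) + l z q' q ^ (b - 1)` in terms of a logarithm `u` of `q`. -/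
noncomputable def logExpr (b : ℝ) (l : ℂ) (u : ℂ → ℂ) (z : ℂ) : ℂ :=
  logChainLeft b u z + z * logChainRight b l u z

section Log

variable {b : ℝ} {l : ℂ} {u a : ℂ → ℂ}

theorem logExpr_zero (h0 : u 0 = 0) : logExpr b l u 0 = 1 := by
  simp [logExpr, logChainLeft, h0]

theorem analyticOnNhd_logChainLeft (hu : AnalyticOnNhd ℂ u unitDisk) :
    AnalyticOnNhd ℂ (logChainLeft b u) unitDisk := fun z hz =>
  (analyticAt_const.mul (hu z hz)).cexp

theorem analyticOnNhd_logChainRight (hu : AnalyticOnNhd ℂ u unitDisk) :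
    AnalyticOnNhd ℂ (logChainRight b l u) unitDisk := fun z hz =>
  (analyticAt_const.mul (hu.deriv z hz)).mul (analyticAt_const.mul (hu z hz)).cexp

theorem analyticOnNhd_logExpr (hu : AnalyticOnNhd ℂ u unitDisk) :
    AnalyticOnNhd ℂ (logExpr b l u) unitDisk := fun z hz =>
  (analyticOnNhd_logChainLeft hu z hz).add
    (analyticAt_id.mul (analyticOnNhd_logChainRight hu z hz))

/-- `T` depends only on the value of the function, and `z S` is linear in `z u'` once that value is
fixed. The factor `m` thus becomes the time of the chain. -/
theorem logChain_eq_of_contact {z ζ : ℂ} {m : ℂ} (h : a z = u ζ)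
    (hd : z * deriv a z = m * (ζ * deriv u ζ)) :
    logChainLeft b a z = logChainLeft b u ζ ∧
      z * logChainRight b l a z = m * (ζ * logChainRight b l u ζ) := by
  refine ⟨by simp [logChainLeft, h], ?_⟩
  simp only [logChainRight, h]
  linear_combination l * Complex.exp (b * u ζ) * hd

theorem injOn_logExpr (hc : IsChainData (logChainLeft b u) (logChainRight b l u)) :
    Set.InjOn (logExpr b l u) unitDisk := by
  simpa [logExpr, Set.InjOn] using hc.injOn zero_le_one

/-- Schwarz functions do not increase the modulus. -/
theorem norm_schwarz_le {w : ℂ → ℂ} (hw : AnalyticOnNhd ℂ w unitDisk) (h0 : w 0 = 0)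
    (hlt : ∀ z ∈ unitDisk, ‖w z‖ < 1) {z : ℂ} (hz : z ∈ unitDisk) : ‖w z‖ ≤ ‖z‖ :=
  Complex.norm_le_norm_of_mapsTo_ball hw.differentiableOn
    (fun x hx => by simpa using (hlt x hx).le) h0 (by simpa using hz)

/-- First-order differential subordination. -/
theorem mapsTo_of_logExpr_subordinate (hu : UnivalentOnDisk u)
    (hc : IsChainData (logChainLeft b u) (logChainRight b l u))
    (ha : AnalyticOnNhd ℂ a unitDisk) (h0 : a 0 = u 0) {w : ℂ → ℂ}
    (hw : AnalyticOnNhd ℂ w unitDisk) (hw0 : w 0 = 0) (hlt : ∀ z ∈ unitDisk, ‖w z‖ < 1)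
    (heq : ∀ z ∈ unitDisk, logExpr b l a z = logExpr b l u (w z)) :
    Set.MapsTo a unitDisk (u '' unitDisk) := by
  by_contra hnot
  obtain ⟨z, hz, ζ, hζ, m, hm, hlt', haz, hd⟩ := hu.exists_contact ha h0 hnot
  obtain ⟨e1, e2⟩ := logChain_eq_of_contact (b := b) (l := l) haz hd
  have hwz : w z ∈ unitDisk := by simpa using hlt z hz
  obtain ⟨v, hv, hveq⟩ := hc.exists_eq_of_le zero_le_one hm hwz
  have hvz : ‖v‖ ≤ ‖z‖ := hv.trans (norm_schwarz_le hw hw0 hlt hz)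
  have hvD : v ∈ unitDisk := by
    have : ‖z‖ < 1 := by simpa using hz
    simpa using hvz.trans_lt this
  have h1 := heq z hz
  simp only [logExpr, e1, e2] at h1
  -- Both points solve the chain equation of `u` at time `m`.
  have : v = ζ := hc.injOn (zero_le_one.trans hm) hvD hζ (by
    simp only [hveq]
    rw [h1]; simp)
  rw [this] at hvz
  exact absurd hvz (not_le.mpr hlt')

/-- First-order differential superordination. -/
theorem mapsTo_of_logExpr_superordinate
    (hc : IsChainData (logChainLeft b u) (logChainRight b l u)) (hu : AnalyticOnNhd ℂ u unitDisk)
    (ha : UnivalentOnDisk a) (h0 : u 0 = a 0) (hinj : Set.InjOn (logExpr b l a) unitDisk)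
    {w : ℂ → ℂ} (hw : AnalyticOnNhd ℂ w unitDisk) (hw0 : w 0 = 0)
    (hlt : ∀ z ∈ unitDisk, ‖w z‖ < 1)
    (heq : ∀ z ∈ unitDisk, logExpr b l u z = logExpr b l a (w z)) :
    Set.MapsTo u unitDisk (a '' unitDisk) := by
  by_contra hnot
  obtain ⟨z, hz, ζ, hζ, m, hm, hlt', huz, hd⟩ := ha.exists_contact hu h0 hnot
  have hm0 : 0 < m := by linarith
  have hmC : (m : ℂ) ≠ 0 := by exact_mod_cast hm0.ne'
  -- The chain belongs to `u`, so the contact is read backwards: the time is `m⁻¹ ≤ 1`, and the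
  -- solution is then continued up to time `1`.
  obtain ⟨e1, e2⟩ := logChain_eq_of_contact (b := b) (l := l) (m := (m : ℂ)⁻¹) huz.symm
    (by rw [hd]; field_simp)
  obtain ⟨v, hv, hveq⟩ := hc.exists_eq_of_le (s := m⁻¹) (inv_nonneg.mpr hm0.le)
    (inv_le_one_of_one_le₀ hm) hz
  have hvD : v ∈ unitDisk := by
    have : ‖z‖ < 1 := by simpa using hz
    simpa using hv.trans_lt this
  have h1 := heq v hvD
  have h2 : logExpr b l u v = logExpr b l a ζ := by
    simp only [logExpr, e1, e2]
    simpa using hveq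
  have : ζ = w v := hinj hζ (by simpa using hlt v hvD) (h2.symm.trans h1)
  have h3 : ‖ζ‖ ≤ ‖v‖ := this ▸ norm_schwarz_le hw hw0 hlt hvD
  exact absurd (h3.trans hv) (not_le.mpr hlt')

/-- The chain conditions for a logarithm of a univalent function. -/
theorem isChainData_log {q : ℂ → ℂ} (hb : 0 < b + 1) (hl : l ≠ 0)
    (hu : UnivalentOnDisk u) (hexp : ∀ z ∈ unitDisk, Complex.exp (u z) = q z)
    (hre : ∀ z ∈ unitDisk, 0 < (1 / l * q z).re)
    (hconv : ∀ z ∈ unitDisk, 0 < (((b : ℂ) - 1) * (z * deriv q z / q z) + 1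
        + z * deriv (deriv q) z / deriv q z).re) :
    IsChainData (logChainLeft b u) (logChainRight b l u) := by
  have hud : ∀ z ∈ unitDisk, HasDerivAt u (deriv u z) z :=
    fun z hz => (hu.1 z hz).differentiableAt.hasDerivAt
  have hudd : ∀ z ∈ unitDisk, HasDerivAt (deriv u) (deriv (deriv u) z) z :=
    fun z hz => (hu.1.deriv z hz).differentiableAt.hasDerivAt
  have hune : ∀ z ∈ unitDisk, deriv u z ≠ 0 := fun z hz => hu.deriv_ne_zero hz
  refine ⟨analyticOnNhd_logChainLeft hu.1, analyticOnNhd_logChainRight hu.1, ?_, ?_, ?_⟩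
  · intro z hz
    exact mul_ne_zero (mul_ne_zero hl (hune z hz)) (Complex.exp_ne_zero _)
  · intro z hz
    have hd : HasDerivAt (logChainLeft b u)
        (Complex.exp ((b + 1) * u z) * ((b + 1) * deriv u z)) z :=
      ((hud z hz).const_mul _).cexp
    have : deriv (logChainLeft b u) z / logChainRight b l u z
        = ((b + 1 : ℝ) : ℂ) * (1 / l * q z) := by
      rw [hd.deriv, logChainRight, ← hexp z hz,
        show ((b : ℂ) + 1) * u z = b * u z + u z by ring, Complex.exp_add]
      have := hune z hz
      have := Complex.exp_ne_zero (b * u z)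
      push_cast
      field_simp
    rw [this, Complex.re_ofReal_mul]
    exact mul_pos hb (hre z hz)
  · intro z hz
    have hq1 : ∀ x ∈ unitDisk, deriv q x = Complex.exp (u x) * deriv u x := by
      intro x hx
      have hqe : q =ᶠ[𝓝 x] fun x => Complex.exp (u x) := by
        filter_upwards [Metric.isOpen_ball.mem_nhds hx] with y hy using (hexp y hy).symm
      rw [hqe.deriv_eq]
      exact (hud x hx).cexp.deriv
    have hq2 : deriv (deriv q) z
        = Complex.exp (u z) * deriv u z * deriv u z + Complex.exp (u z) * deriv (deriv u) z := by
      have he : deriv q =ᶠ[𝓝 z] fun x => Complex.exp (u x) * deriv u x := by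
        filter_upwards [Metric.isOpen_ball.mem_nhds hz] with x hx using hq1 x hx
      rw [he.deriv_eq]
      exact ((hud z hz).cexp.mul (hudd z hz)).deriv
    have hd : HasDerivAt (logChainRight b l u) (l * deriv (deriv u) z * Complex.exp (b * u z)
        + l * deriv u z * (Complex.exp (b * u z) * (b * deriv u z))) z :=
      ((hudd z hz).const_mul l).mul ((hud z hz).const_mul _).cexp
    have hc := hconv z hz
    rw [hq2, hq1 z hz, ← hexp z hz] at hc
    -- With `q' = q u'` and `q'' / q' = u' + u'' / u'`, both sides are `1 + z u'' / u' + b z u'`.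
    convert hc using 2
    rw [hd.deriv, logChainRight]
    have := hune z hz
    have := Complex.exp_ne_zero (b * u z)
    have := Complex.exp_ne_zero (u z)
    field_simp
    ring

end Log

/-! ### From principal powers to logarithms -/

theorem starQuot_zero (f : ℂ → ℂ) : starQuot f 0 = 1 := by simp [starQuot]

theorem starQuot_of_ne (f : ℂ → ℂ) {z : ℂ} (hz : z ≠ 0) : starQuot f z = z * deriv f z / f z := by
  simp [starQuot, hz]

/-- The second factor of `mixedExpr` in terms of a logarithm of `starQuot f`. -/
theorem mixedExpr_factor_eq {f u : ℂ → ℂ} (hf : MemA f) (hu : AnalyticOnNhd ℂ u unitDisk)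
    (hexp : ∀ z ∈ unitDisk, Complex.exp (u z) = starQuot f z) (l : ℂ) {z : ℂ}
    (hz : z ∈ unitDisk) :
    (1 - l) * starQuot f z + l * (1 + z * deriv (deriv f) z / deriv f z)
      = Complex.exp (u z) + l * (z * deriv u z) := by
  by_cases hz0 : z = 0
  · subst hz0
    simp [hexp 0 hz, starQuot_zero]
  have hq := starQuot_of_ne f hz0
  have hqne : starQuot f z ≠ 0 := by rw [← hexp z hz]; exact Complex.exp_ne_zero _
  have hfz : f z ≠ 0 := by rintro h; rw [hq, h] at hqne; simp at hqne
  have hfd : deriv f z ≠ 0 := by rintro h; rw [hq, h] at hqne; simp at hqne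
  have he : (fun x => Complex.exp (u x)) =ᶠ[𝓝 z] fun x => x * deriv f x / f x := by
    filter_upwards [Metric.isOpen_ball.mem_nhds hz, isOpen_ne.mem_nhds hz0] with x hx hx0
    rw [hexp x hx, starQuot_of_ne f hx0]
  have h1 : HasDerivAt (fun x => Complex.exp (u x)) (Complex.exp (u z) * deriv u z) z :=
    (hu z hz).differentiableAt.hasDerivAt.cexp
  have h2 : HasDerivAt (fun x => x * deriv f x / f x)
      (((1 * deriv f z + z * deriv (deriv f) z) * f z - z * deriv f z * deriv f z) / f z ^ 2) z :=
    ((hasDerivAt_id z).mul (hf.1.deriv z hz).differentiableAt.hasDerivAt).div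
      (hf.1 z hz).differentiableAt.hasDerivAt hfz
  have h3 := h1.unique (h2.congr_of_eventuallyEq he)
  rw [hexp z hz, hq] at h3
  have h4 : z * deriv u z = 1 + z * deriv (deriv f) z / deriv f z - z * deriv f z / f z := by
    field_simp at h3 ⊢
    linear_combination h3
  rw [hexp z hz, h4, hq]
  ring

/-- Principal powers need not multiply, but for real exponents their moduli do, so no choice of
branch enters. -/
theorem norm_mixedExpr {α μ : ℝ} (hμ : μ ≠ 0) {f u : ℂ → ℂ} (hf : MemA f)
    (hu : AnalyticOnNhd ℂ u unitDisk)
    (hexp : ∀ z ∈ unitDisk, Complex.exp (u z) = starQuot f z) (l : ℂ) {z : ℂ}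
    (hz : z ∈ unitDisk) :
    ‖mixedExpr α μ l f z‖ = ‖logExpr (α / μ) l u z‖ ^ μ := by
  have h1 : logExpr (α / μ) l u z
      = Complex.exp ((α / μ : ℝ) * u z) * (Complex.exp (u z) + l * (z * deriv u z)) := by
    simp only [logExpr, logChainLeft, logChainRight]
    rw [add_mul, one_mul, Complex.exp_add]
    ring
  rw [h1, mixedExpr, mixedExpr_factor_eq hf hu hexp l hz, ← hexp z hz, norm_mul, norm_mul,
    Complex.norm_cpow_real, Complex.norm_cpow_real,
    Real.mul_rpow (norm_nonneg _) (norm_nonneg _), Complex.norm_exp, Complex.norm_exp,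
    ← Real.exp_mul, ← Real.exp_mul, Complex.re_ofReal_mul]
  congr 2
  field_simp

/-- Subordination of the mixed expressions passes to the logarithmic expressions. -/
theorem logExpr_eq_comp {α μ : ℝ} (hμ : 0 < μ) {l : ℂ} {f g u v w : ℂ → ℂ} (hf : MemA f)
    (hg : MemA g) (hu : AnalyticOnNhd ℂ u unitDisk) (hv : AnalyticOnNhd ℂ v unitDisk)
    (hu0 : u 0 = 0) (hv0 : v 0 = 0)
    (hue : ∀ z ∈ unitDisk, Complex.exp (u z) = starQuot f z)
    (hve : ∀ z ∈ unitDisk, Complex.exp (v z) = starQuot g z)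
    (hw : AnalyticOnNhd ℂ w unitDisk) (hw0 : w 0 = 0) (hlt : ∀ z ∈ unitDisk, ‖w z‖ < 1)
    (heq : ∀ z ∈ unitDisk, mixedExpr α μ l f z = mixedExpr α μ l g (w z)) :
    ∀ z ∈ unitDisk, logExpr (α / μ) l u z = logExpr (α / μ) l v (w z) := by
  have hwD : ∀ z ∈ unitDisk, w z ∈ unitDisk := fun z hz => by simpa using hlt z hz
  refine eqOn_unitDisk_of_norm_eq (analyticOnNhd_logExpr hu)
    (G := fun z => logExpr (α / μ) l v (w z))
    (fun z hz => (analyticOnNhd_logExpr hv _ (hwD z hz)).comp (hw z hz))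
    (by simp [hw0, logExpr_zero, hu0, hv0]) (by simp [hw0, logExpr_zero, hv0]) ?_
  intro z hz
  have h := congrArg norm (heq z hz)
  rw [norm_mixedExpr hμ.ne' hf hu hue l hz, norm_mixedExpr hμ.ne' hg hv hve l (hwD z hz)] at h
  exact (Real.rpow_left_inj (norm_nonneg _) (norm_nonneg _) hμ.ne').mp h

theorem UnivalentOnDisk.log {q u : ℂ → ℂ} (hq : Set.InjOn q unitDisk)
    (hu : AnalyticOnNhd ℂ u unitDisk) (hexp : ∀ z ∈ unitDisk, Complex.exp (u z) = q z) :
    UnivalentOnDisk u :=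
  ⟨hu, fun x hx y hy hxy => hq hx hy (by rw [← hexp x hx, ← hexp y hy, hxy])⟩

/-- Inclusion of the images of the logarithms gives subordination. -/
theorem subordinateTo_of_mapsTo_log {p q a u : ℂ → ℂ} (hp : AnalyticOnNhd ℂ p unitDisk)
    (hq : AnalyticOnNhd ℂ q unitDisk) (ha : AnalyticOnNhd ℂ a unitDisk) (hu : UnivalentOnDisk u)
    (h0 : a 0 = u 0) (hap : ∀ z ∈ unitDisk, Complex.exp (a z) = p z)
    (huq : ∀ z ∈ unitDisk, Complex.exp (u z) = q z)
    (hmaps : Set.MapsTo a unitDisk (u '' unitDisk)) : SubordinateTo p q := by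
  obtain ⟨v, hv, hvu, -⟩ := hu.exists_inverse
  have hkey : ∀ z ∈ unitDisk, v (a z) ∈ unitDisk ∧ u (v (a z)) = a z := by
    intro z hz
    obtain ⟨x, hx, hxa⟩ := hmaps hz
    rw [← hxa, hvu x hx]
    exact ⟨hx, rfl⟩
  refine ⟨hp, hq, fun z => v (a z), fun z hz => (hv _ (hmaps hz)).comp (ha z hz), ?_, ?_, ?_⟩
  · simp only [h0]
    exact hvu 0 (by simp)
  · intro z hz
    simpa using (hkey z hz).1
  · intro z hz
    rw [← hap z hz, ← huq _ (hkey z hz).1, (hkey z hz).2]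

/-! ### The sandwich theorem -/

theorem theorem4 (α μ : ℝ) (hμ0 : 0 < μ) (hμ1 : μ ≤ 1) (hαμ : 0 < α + μ)
    (l : ℂ) (hl : l ≠ 0)
    (g₁ g₂ f : ℂ → ℂ) (hg₁ : MemA g₁) (hg₂ : MemA g₂) (hf : MemA f)
    (hq₁ : UnivalentOnDisk (starQuot g₁)) (hq₂ : UnivalentOnDisk (starQuot g₂))
    (hre₁ : ∀ z ∈ unitDisk, 0 < (1 / l * starQuot g₁ z).re)
    (hre₂ : ∀ z ∈ unitDisk, 0 < (1 / l * starQuot g₂ z).re)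
    (hconv₁ : ∀ z ∈ unitDisk,
      0 < (((α : ℂ) / (μ : ℂ) - 1) * (z * deriv (starQuot g₁) z / starQuot g₁ z) + 1
        + z * deriv (deriv (starQuot g₁)) z / deriv (starQuot g₁) z).re)
    (hconv₂ : ∀ z ∈ unitDisk,
      0 < (((α : ℂ) / (μ : ℂ) - 1) * (z * deriv (starQuot g₂) z / starQuot g₂ z) + 1
        + z * deriv (deriv (starQuot g₂)) z / deriv (starQuot g₂) z).re)
    (hpne : ∀ z ∈ unitDisk, starQuot f z ≠ 0)
    (hpH : MemH 1 1 (starQuot f)) (hpQ : MemQ (starQuot f))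
    (hP : UnivalentOnDisk (mixedExpr α μ l f))
    (hsub₁ : SubordinateTo (mixedExpr α μ l g₁) (mixedExpr α μ l f))
    (hsub₂ : SubordinateTo (mixedExpr α μ l f) (mixedExpr α μ l g₂)) :
    SubordinateTo (starQuot g₁) (starQuot f) ∧ SubordinateTo (starQuot f) (starQuot g₂) := by

  have hne : ∀ g : ℂ → ℂ, (∀ z ∈ unitDisk, 0 < (1 / l * starQuot g z).re) →
      ∀ z ∈ unitDisk, starQuot g z ≠ 0 := by
    intro g hg z hz h
    have := hg z hz
    simp [h] at this
  obtain ⟨u₁, hu₁, hu₁0, hu₁e⟩ := exists_log_unitDisk hq₁.1 (hne g₁ hre₁) (starQuot_zero g₁)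
  obtain ⟨u₂, hu₂, hu₂0, hu₂e⟩ := exists_log_unitDisk hq₂.1 (hne g₂ hre₂) (starQuot_zero g₂)
  obtain ⟨a, ha, ha0, hae⟩ := exists_log_unitDisk hpH.1 hpne (starQuot_zero f)
  have hinjp : Set.InjOn (starQuot f) unitDisk := by
    obtain ⟨F, hFf, -, hFinj, -⟩ := hpQ
    have hsub : unitDisk ⊆ Metric.closedBall (0 : ℂ) 1 \ exceptionalSet (starQuot f) := by
      intro z hz
      refine ⟨Metric.ball_subset_closedBall hz, fun hE => ?_⟩
      have h1 : ‖z‖ < 1 := by simpa using hz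
      have h2 : ‖z‖ = 1 := by simpa using hE.1
      exact h1.ne h2
    exact (hFinj.mono hsub).congr hFf
  have hau := UnivalentOnDisk.log hinjp ha hae
  have hu₁u := UnivalentOnDisk.log hq₁.2 hu₁ hu₁e
  have hu₂u := UnivalentOnDisk.log hq₂.2 hu₂ hu₂e
  have hb : 0 < α / μ + 1 := by
    rw [div_add_one hμ0.ne']
    exact div_pos hαμ hμ0
  have hc₁ := isChainData_log (b := α / μ) hb hl hu₁u hu₁e hre₁ (by push_cast; exact hconv₁)
  have hc₂ := isChainData_log (b := α / μ) hb hl hu₂u hu₂e hre₂ (by push_cast; exact hconv₂)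
  obtain ⟨-, -, w₁, hw₁, hw₁0, hw₁l, hw₁e⟩ := hsub₁
  obtain ⟨-, -, w₂, hw₂, hw₂0, hw₂l, hw₂e⟩ := hsub₂
  have e₁ := logExpr_eq_comp hμ0 hg₁ hf hu₁ ha hu₁0 ha0 hu₁e hae hw₁ hw₁0 hw₁l hw₁e
  have e₂ := logExpr_eq_comp hμ0 hf hg₂ ha hu₂ ha0 hu₂0 hae hu₂e hw₂ hw₂0 hw₂l hw₂e
  -- Injectivity passes from `mixedExpr α μ l f` to `logExpr` through `w₂`: equal values of
  -- `logExpr` give equal values of `w₂`, since the expression of `u₂` is injective, and hence equal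
  -- values of `mixedExpr`.
  have hinj : Set.InjOn (logExpr (α / μ) l a) unitDisk := by
    intro x hx y hy hxy
    rw [e₂ x hx, e₂ y hy] at hxy
    have hw := injOn_logExpr hc₂ (by simpa using hw₂l x hx) (by simpa using hw₂l y hy) hxy
    exact hP.2 hx hy (by rw [hw₂e x hx, hw₂e y hy, hw])
  constructor
  · exact subordinateTo_of_mapsTo_log hq₁.1 hpH.1 hu₁ hau (hu₁0.trans ha0.symm) hu₁e hae
      (mapsTo_of_logExpr_superordinate hc₁ hu₁ hau (hu₁0.trans ha0.symm) hinj hw₁ hw₁0 hw₁l e₁)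
  · exact subordinateTo_of_mapsTo_log hpH.1 hq₂.1 ha hu₂u (ha0.trans hu₂0.symm) hae hu₂e
      (mapsTo_of_logExpr_subordinate hu₂u hc₂ ha (ha0.trans hu₂0.symm) hw₂ hw₂0 hw₂l e₂)
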